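/- Consider a semidefinite system $$P_{SD}=\Big\{x\in\mathbb R^m \;\Big|\; \sum_{i=1}^m x_iA_i\preceq B\Big\},$$ where $A_1,\dots,A_m,B$ are real symmetric $n\times n$ matrices ($m,n\ge 0$), and $S\preceq T$ means that $T-S$ is positive semidefinite. Write $S\bullet T=\sum_{i,j}s_{ij}t_{ij}$. The system is called *well-behaved* if for every $c\in\mathbb R^m$ for which $v=\sup\{\sum_i c_ix_i : x\in P_{SD}\}$ is finite (in particular $P_{SD}\neq\emptyset$), there is a symmetric $Y\succeq 0$ with $A_i\bullet Y=c_i$ for $i=1,\dots,m$ and $B\bullet Y=v$; otherwise it is called *badly behaved*. Consider the following four elementary operations on a system given by $(A_1,\dots,A_m;B)$: 1. Rotation: for some invertible matrix $T$, replace $A_1,\dots,A_m$ by $T^{T}A_1T,\dots,T^{T}A_mT$, and $B$ by $T^{T}BT$. 2. Contraction: for some index $i$ and scalars $\lambda_j,\mu_j$ with $\lambda_i\neq 0$, replace $A_i$ by $\sum_{j=1}^m\lambda_jA_j$ and $B$ by $B+\sum_{j=1}^m\mu_jA_j$. 3. Delete row $\ell$ and column $\ell$ from all matrices. 4. Delete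 a matrix $A_i$. If $P_{SD}$ is badly behaved, then by finitely many of these operations one can arrive at the system $$x_1\begin{pmatrix}\alpha&1\\1&0\end{pmatrix}\preceq\begin{pmatrix}1&0\\0&0\end{pmatrix}$$ for some real number $\alpha$. Moreover, for every real number $\alpha$ this $2\times 2$ system is itself badly behaved. -/

import Mathlib

open scoped BigOperators Matrix

/-- A semidefinite system `∑ i, x i • A i ⪯ B` in `m` real variables, given by its data:
symmetric `n × n` real matrices `A 0, …, A (m - 1)` and `B`. -/
@[ext]
structure SDSystem (m n : ℕ) where
  A : Fin m → Matrix (Fin n) (Fin n) ℝ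
  B : Matrix (Fin n) (Fin n) ℝ
  A_symm : ∀ i, (A i).IsSymm
  B_symm : B.IsSymm

namespace SDSystem

/-- The inner product `S • T = ∑ i j, s i j * t i j` of real matrices. -/
def matrixInner {n : ℕ} (S T : Matrix (Fin n) (Fin n) ℝ) : ℝ :=
  ∑ i, ∑ j, S i j * T i j

/-- The solution set of the system: `∑ i, x i • A i ⪯ B` in the Loewner order. -/
def feasibleSet {m n : ℕ} (P : SDSystem m n) : Set (Fin m → ℝ) :=
  {x | (P.B - ∑ i, x i • P.A i).PosSemidef}

/-- The feasible set of the dual program for the objective `c`: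
`Y ⪰ 0` and `A i • Y = c i` for all `i`. -/
def dualFeasibleSet {m n : ℕ} (P : SDSystem m n) (c : Fin m → ℝ) :
    Set (Matrix (Fin n) (Fin n) ℝ) :=
  {Y | Y.PosSemidef ∧ ∀ i, matrixInner (P.A i) Y = c i}

/-- `sup {∑ i, c i * x i | x feasible}` is finite and equal to the real number `v`.
(No real number is a least upper bound of the empty set or of an unbounded set, so this
fails for infeasible problems, of value `-∞`, and for unbounded ones, of value `+∞`.) -/
def HasFiniteValue {m n : ℕ} (P : SDSystem m n) (c : Fin m → ℝ) (v : ℝ) : Prop :=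
  IsLUB ((fun x : Fin m → ℝ => ∑ i, c i * x i) '' P.feasibleSet) v

/-- Whenever the primal value is finite, some dual feasible solution attains the same value. -/
def WellBehaved {m n : ℕ} (P : SDSystem m n) : Prop :=
  ∀ (c : Fin m → ℝ) (v : ℝ), P.HasFiniteValue c v →
    ∃ Y ∈ P.dualFeasibleSet c, matrixInner P.B Y = v

def BadlyBehaved {m n : ℕ} (P : SDSystem m n) : Prop :=
  ¬ P.WellBehaved

/-- Rotation: replace every `A i` by `Tᵀ A i T` and `B` by `Tᵀ B T`. -/
def rotate {m n : ℕ} (P : SDSystem m n) (T : Matrix (Fin n) (Fin n) ℝ) : SDSystem m n where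
  A := fun i => Tᵀ * P.A i * T
  B := Tᵀ * P.B * T
  A_symm := fun i => by
    simp [Matrix.IsSymm, Matrix.transpose_mul, (P.A_symm i).eq, Matrix.mul_assoc]
  B_symm := by
    simp [Matrix.IsSymm, Matrix.transpose_mul, P.B_symm.eq, Matrix.mul_assoc]

theorem isSymm_combination {m n : ℕ} (P : SDSystem m n) (c : Fin m → ℝ) :
    (∑ j, c j • P.A j).IsSymm := by
  simp [Matrix.IsSymm, Matrix.transpose_sum, (P.A_symm _).eq]

/-- Contraction: replace the single matrix `A i` by `∑ j, lam j • A j` and `B` by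
`B + ∑ j, mu j • A j`; the other `A j` stay. -/
def contract {m n : ℕ} (P : SDSystem m n) (i : Fin m) (lam mu : Fin m → ℝ) :
    SDSystem m n where
  A := Function.update P.A i (∑ j, lam j • P.A j)
  B := P.B + ∑ j, mu j • P.A j
  A_symm := fun k => by
    rcases eq_or_ne k i with rfl | hk
    · simpa using P.isSymm_combination lam
    · simpa [Function.update_of_ne hk] using P.A_symm k
  B_symm := P.B_symm.add (P.isSymm_combination mu)

/-- Delete row `l` and column `l` from all matrices. -/
def deleteRowCol {m n : ℕ} (P : SDSystem m (n + 1)) (l : Fin (n + 1)) : SDSystem m n where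
  A := fun i => (P.A i).submatrix l.succAbove l.succAbove
  B := P.B.submatrix l.succAbove l.succAbove
  A_symm := fun i => (P.A_symm i).submatrix _
  B_symm := P.B_symm.submatrix _

/-- Delete the matrix `A i` (and the variable `x i`), renumbering the remaining ones in order. -/
def deleteMatrix {m n : ℕ} (P : SDSystem (m + 1) n) (i : Fin (m + 1)) : SDSystem m n where
  A := fun j => P.A (i.succAbove j)
  B := P.B
  A_symm := fun j => P.A_symm (i.succAbove j)
  B_symm := P.B_symm

/-- One elementary operation. -/
inductive Step : ∀ {m n m' n' : ℕ}, SDSystem m n → SDSystem m' n' → Prop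
  | rotation {m n : ℕ} (P : SDSystem m n) (T : Matrix (Fin n) (Fin n) ℝ) (hT : IsUnit T) :
      Step P (P.rotate T)
  | contraction {m n : ℕ} (P : SDSystem m n) (i : Fin m) (lam mu : Fin m → ℝ)
      (hlam : lam i ≠ 0) : Step P (P.contract i lam mu)
  | rowColDeletion {m n : ℕ} (P : SDSystem m (n + 1)) (l : Fin (n + 1)) :
      Step P (P.deleteRowCol l)
  | matrixDeletion {m n : ℕ} (P : SDSystem (m + 1) n) (i : Fin (m + 1)) :
      Step P (P.deleteMatrix i)

/-- `P.ReducesTo Q`: the system `Q` arises from `P` by finitely many elementary operations. -/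
inductive ReducesTo {m n : ℕ} (P : SDSystem m n) : ∀ {m' n' : ℕ}, SDSystem m' n' → Prop
  | refl : ReducesTo P P
  | tail {m₁ n₁ m₂ n₂ : ℕ} {Q : SDSystem m₁ n₁} {R : SDSystem m₂ n₂} :
      ReducesTo P Q → Step Q R → ReducesTo P R

/-- The system `x₁ [[α, 1], [1, 0]] ⪯ [[1, 0], [0, 0]]` in one variable. -/
def badMinor (α : ℝ) : SDSystem 1 2 where
  A := fun _ => !![α, 1; 1, 0]
  B := !![1, 0; 0, 0]
  A_symm := fun _ => by ext i j; fin_cases i <;> fin_cases j <;> rfl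
  B_symm := by ext i j; fin_cases i <;> fin_cases j <;> rfl

end SDSystem

/-! Take a slack `Z = B - ∑ x₀ᵢ Aᵢ` with the smallest possible kernel. The heart is
`BadlyBehaved.exists_certificate`: bad behaviour yields `V = ∑ yᵢ Aᵢ`, nonnegative on `ker Z`, and
`w ∈ ker Z` with `wᵀVw = 0` but `Vw ≠ 0`. Suppose there is no such pair. If `V` is nonnegative on
`ker Z`, Finsler's lemma (`exists_add_smul_posSemidef`) makes `V + tZ` semidefinite; up to scaling
it is again a slack, so minimality of `ker Z` forces `V` to annihilate `ker Z`. Then the image of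
the semidefinite cone under `Y ↦ (Aᵢ • Y, B • Y)` is closed (`isClosed_image_dualMap`), and
separation gives an attained dual without gap (`wellBehaved_of_isClosed`). Conversely, contraction
turns one matrix into `V` and `B` into `Z`. The vector `u = Vw` satisfies `uᵀZu > 0`; after scaling
`u` and `w`, a rotation whose first columns they are produces the 2×2 system as the leading block.
-/

/-! ### Compactness and Finsler's lemma -/

/-- A continuous function that is positive on the zero set of a nonnegative continuous function
becomes positive on a compact set after adding a large multiple of the latter. -/
theorem IsCompact.exists_pos_add_mul_pos {X : Type*} [TopologicalSpace X] {K : Set X}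
    (hK : IsCompact K) {f g : X → ℝ} (hf : Continuous f) (hg : Continuous g)
    (hg0 : ∀ x ∈ K, 0 ≤ g x) (hfg : ∀ x ∈ K, g x = 0 → 0 < f x) :
    ∃ t : ℝ, 0 < t ∧ ∀ x ∈ K, 0 < f x + t * g x := by
  have hK' : IsCompact (K ∩ {x | f x ≤ 0}) :=
    hK.inter_right (isClosed_le hf continuous_const)
  rcases (K ∩ {x | f x ≤ 0}).eq_empty_or_nonempty with he | hne
  · refine ⟨1, one_pos, fun x hx => ?_⟩
    have : ¬ f x ≤ 0 := fun h => by
      have : x ∈ K ∩ {x | f x ≤ 0} := ⟨hx, h⟩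
      simp [he] at this
    have := hg0 x hx
    linarith
  · obtain ⟨a, ha, hamin⟩ := hK'.exists_isMinOn hne hg.continuousOn
    obtain ⟨b, hb, hbmin⟩ := hK'.exists_isMinOn hne hf.continuousOn
    have hga : 0 < g a := by
      refine lt_of_le_of_ne (hg0 a ha.1) fun h => ?_
      exact absurd (hfg a ha.1 h.symm) (not_lt.2 ha.2)
    have hfb : f b ≤ 0 := hb.2
    -- Where `f ≤ 0` on `K`, `f ≥ f b` and `g ≥ g a`, so this multiple gives a sum of at least 1.
    refine ⟨(1 - f b) / g a, div_pos (by linarith) hga, fun x hx => ?_⟩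
    have ht : 0 < (1 - f b) / g a := div_pos (by linarith) hga
    by_cases hx0 : f x ≤ 0
    · have h1 : g a ≤ g x := hamin ⟨hx, hx0⟩
      have h2 : f b ≤ f x := hbmin ⟨hx, hx0⟩
      have h3 : (1 - f b) / g a * g a ≤ (1 - f b) / g a * g x :=
        mul_le_mul_of_nonneg_left h1 ht.le
      rw [div_mul_cancel₀ _ hga.ne'] at h3
      linarith
    · have := mul_nonneg ht.le (hg0 x hx)
      linarith

namespace Matrix

variable {n : ℕ}

/-- The matrix of the orthogonal projection onto a subspace of `ℝⁿ`. -/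
theorem exists_orthogonalProjection (N : Submodule ℝ (Fin n → ℝ)) :
    ∃ Q : Matrix (Fin n) (Fin n) ℝ, Qᵀ = Q ∧ Q * Q = Q ∧ (∀ x, Q *ᵥ x ∈ N) ∧
      ∀ x ∈ N, Q *ᵥ x = x := by
  let e := (WithLp.linearEquiv 2 ℝ (Fin n → ℝ))
  let N' : Submodule ℝ (EuclideanSpace ℝ (Fin n)) := N.comap e.toLinearMap
  let p := N'.starProjection
  let Q : Matrix (Fin n) (Fin n) ℝ := Matrix.toEuclideanLin.symm p.toLinearMap
  have hQ : Matrix.toEuclideanLin Q = p.toLinearMap := by simp [Q]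
  have hQx : ∀ x, Q *ᵥ x = e (p (e.symm x)) := by
    intro x
    have : p (e.symm x) = Matrix.toEuclideanLin Q (e.symm x) := by rw [hQ]; rfl
    rw [this]; rfl
  have hmem : ∀ x, Q *ᵥ x ∈ N := by
    intro x
    rw [hQx]
    exact N'.starProjection_apply_mem (e.symm x)
  have hfix : ∀ x ∈ N, Q *ᵥ x = x := by
    intro x hx
    rw [hQx]
    have : p (e.symm x) = e.symm x := Submodule.starProjection_eq_self_iff.2 (by simpa [N'] using hx)
    rw [this]; simp
  refine ⟨Q, ?_, ?_, hmem, hfix⟩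
  · have h : Q.IsHermitian := by
      rw [← Matrix.isSymmetric_toEuclideanLin_iff, hQ]
      exact N'.starProjection_isSymmetric
    simpa [Matrix.IsHermitian, Matrix.conjTranspose_eq_transpose_of_trivial] using h
  · apply Matrix.toLin'.injective
    apply LinearMap.ext
    intro x
    simp only [Matrix.toLin'_apply, ← Matrix.mulVec_mulVec]
    exact hfix _ (hmem x)

theorem posSemidef_iff_real {M : Matrix (Fin n) (Fin n) ℝ} :
    M.PosSemidef ↔ Mᵀ = M ∧ ∀ x, 0 ≤ x ⬝ᵥ M *ᵥ x := by
  rw [Matrix.posSemidef_iff_dotProduct_mulVec]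
  simp [Matrix.IsHermitian, Matrix.conjTranspose_eq_transpose_of_trivial]

theorem PosSemidef.mulVec_eq_zero {M : Matrix (Fin n) (Fin n) ℝ} (hM : M.PosSemidef)
    {x : Fin n → ℝ} (hx : x ⬝ᵥ M *ᵥ x = 0) : M *ᵥ x = 0 := by
  exact (hM.dotProduct_mulVec_zero_iff x).1 (by simpa using hx)

theorem dotProduct_mulVec_comm_of_symm {M : Matrix (Fin n) (Fin n) ℝ} (hM : Mᵀ = M)
    (x y : Fin n → ℝ) : x ⬝ᵥ M *ᵥ y = (M *ᵥ x) ⬝ᵥ y := by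
  conv_rhs => rw [← hM]
  rw [Matrix.dotProduct_mulVec, Matrix.mulVec_transpose]

/-- A version of Finsler's lemma: a quadratic form that is nonnegative on `ker Z`, and whose
isotropic vectors there lie in its kernel, is dominated by a multiple of `Z`. -/
theorem exists_add_smul_posSemidef {V Z : Matrix (Fin n) (Fin n) ℝ} (hV : Vᵀ = V)
    (hZ : Z.PosSemidef) (h0 : ∀ w, Z *ᵥ w = 0 → 0 ≤ w ⬝ᵥ V *ᵥ w)
    (h1 : ∀ w, Z *ᵥ w = 0 → w ⬝ᵥ V *ᵥ w = 0 → V *ᵥ w = 0) :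
    ∃ t : ℝ, 0 < t ∧ (V + t • Z).PosSemidef := by
  obtain ⟨hZs, hZ0⟩ := posSemidef_iff_real.1 hZ
  -- The common kernel of `V` and `Z` is the only obstruction to strict positivity. Adding `‖Qx‖²`
  -- removes it on the sphere; afterwards `x` is replaced by `x - Qx`, which changes neither form.
  obtain ⟨Q, hQs, hQQ, hQm, hQf⟩ := exists_orthogonalProjection
    (LinearMap.ker (Matrix.toLin' V) ⊓ LinearMap.ker (Matrix.toLin' Z))
  simp only [Submodule.mem_inf, LinearMap.mem_ker, Matrix.toLin'_apply] at hQm hQf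
  obtain ⟨t, ht, hpos⟩ := (isCompact_sphere (0 : Fin n → ℝ) 1).exists_pos_add_mul_pos
    (f := fun x => x ⬝ᵥ V *ᵥ x + (Q *ᵥ x) ⬝ᵥ (Q *ᵥ x)) (g := fun x => x ⬝ᵥ Z *ᵥ x)
    (by fun_prop) (by fun_prop) (fun x _ => hZ0 x) (by
      intro x hx hx0
      have hxZ := hZ.mulVec_eq_zero hx0
      have hq : 0 ≤ (Q *ᵥ x) ⬝ᵥ (Q *ᵥ x) := by
        simpa using dotProduct_star_self_nonneg (Q *ᵥ x)
      have hv := h0 x hxZ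
      refine lt_of_le_of_ne (add_nonneg hv hq) fun h => ?_
      have hv0 : x ⬝ᵥ V *ᵥ x = 0 := by linarith
      have hq0 : (Q *ᵥ x) ⬝ᵥ (Q *ᵥ x) = 0 := by linarith
      have := hQf x ⟨h1 x hxZ hv0, hxZ⟩
      rw [dotProduct_self_eq_zero, this] at hq0
      simp [hq0] at hx)
  refine ⟨t, ht, posSemidef_iff_real.2 ⟨by simp [hV, hZs], fun x => ?_⟩⟩
  set y := x - Q *ᵥ x with hy
  have hM : (V + t • Z) *ᵥ (Q *ᵥ x) = 0 := by
    rw [Matrix.add_mulVec, Matrix.smul_mulVec, (hQm x).1, (hQm x).2]; simp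
  have hsym : (V + t • Z)ᵀ = V + t • Z := by simp [hV, hZs]
  have hxy : x ⬝ᵥ (V + t • Z) *ᵥ x = y ⬝ᵥ (V + t • Z) *ᵥ y := by
    have e1 : (V + t • Z) *ᵥ y = (V + t • Z) *ᵥ x := by rw [hy, Matrix.mulVec_sub, hM, sub_zero]
    rw [e1, hy, sub_dotProduct, dotProduct_mulVec_comm_of_symm hsym (Q *ᵥ x), hM]
    simp
  have hQy : Q *ᵥ y = 0 := by
    rw [hy, Matrix.mulVec_sub, Matrix.mulVec_mulVec, hQQ, sub_self]
  rw [hxy]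
  rcases eq_or_ne y 0 with h | h
  · simp [h]
  · have hn : 0 < ‖y‖ := norm_pos_iff.2 h
    have := hpos (‖y‖⁻¹ • y) (by simp [norm_smul, hn.ne'])
    simp only [Matrix.mulVec_smul, hQy, smul_dotProduct, dotProduct_smul, smul_zero,
      zero_dotProduct, add_zero, smul_eq_mul] at this
    rw [Matrix.add_mulVec, Matrix.smul_mulVec, dotProduct_add, dotProduct_smul, smul_eq_mul]
    have h2 : 0 < ‖y‖⁻¹ * ‖y‖⁻¹ := by positivity
    have h3 : 0 < (‖y‖⁻¹ * ‖y‖⁻¹) * (y ⬝ᵥ V *ᵥ y + t * y ⬝ᵥ Z *ᵥ y) := by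
      convert this using 1; ring
    exact (pos_of_mul_pos_right h3 h2.le).le

end Matrix

/-! ### The inner product and the semidefinite cone -/

namespace SDSystem

open Matrix

variable {m n : ℕ}

theorem matrixInner_eq_trace (S T : Matrix (Fin n) (Fin n) ℝ) :
    matrixInner S T = (Sᵀ * T).trace := by
  simp only [matrixInner, Matrix.trace, Matrix.diag, Matrix.mul_apply, Matrix.transpose_apply]
  exact Finset.sum_comm

theorem matrixInner_comm (S T : Matrix (Fin n) (Fin n) ℝ) :
    matrixInner S T = matrixInner T S := by
  simp [matrixInner, mul_comm]

theorem matrixInner_add_left (S S' T : Matrix (Fin n) (Fin n) ℝ) :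
    matrixInner (S + S') T = matrixInner S T + matrixInner S' T := by
  simp [matrixInner, add_mul, Finset.sum_add_distrib]

theorem matrixInner_add_right (S T T' : Matrix (Fin n) (Fin n) ℝ) :
    matrixInner S (T + T') = matrixInner S T + matrixInner S T' := by
  simp [matrixInner, mul_add, Finset.sum_add_distrib]

theorem matrixInner_smul_left (a : ℝ) (S T : Matrix (Fin n) (Fin n) ℝ) :
    matrixInner (a • S) T = a * matrixInner S T := by
  simp [matrixInner, mul_assoc, Finset.mul_sum]

theorem matrixInner_smul_right (a : ℝ) (S T : Matrix (Fin n) (Fin n) ℝ) :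
    matrixInner S (a • T) = a * matrixInner S T := by
  rw [matrixInner_comm, matrixInner_smul_left, matrixInner_comm]

/-- `matrixInner` as a bilinear map. -/
noncomputable def matrixInnerₗ (n : ℕ) :
    Matrix (Fin n) (Fin n) ℝ →ₗ[ℝ] Matrix (Fin n) (Fin n) ℝ →ₗ[ℝ] ℝ :=
  LinearMap.mk₂ ℝ matrixInner matrixInner_add_left matrixInner_smul_left
    matrixInner_add_right matrixInner_smul_right

@[simp] theorem matrixInnerₗ_apply (S T : Matrix (Fin n) (Fin n) ℝ) :
    matrixInnerₗ n S T = matrixInner S T := rfl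

theorem matrixInner_sub_left (S S' T : Matrix (Fin n) (Fin n) ℝ) :
    matrixInner (S - S') T = matrixInner S T - matrixInner S' T :=
  (matrixInnerₗ n).map_sub₂ S S' T

theorem matrixInner_sub_right (S T T' : Matrix (Fin n) (Fin n) ℝ) :
    matrixInner S (T - T') = matrixInner S T - matrixInner S T' :=
  (matrixInnerₗ n S).map_sub T T'

theorem matrixInner_sum_smul_left (y : Fin m → ℝ) (A : Fin m → Matrix (Fin n) (Fin n) ℝ)
    (T : Matrix (Fin n) (Fin n) ℝ) :
    matrixInner (∑ i, y i • A i) T = ∑ i, y i * matrixInner (A i) T := by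
  rw [← matrixInnerₗ_apply, map_sum, LinearMap.sum_apply]
  simp

theorem matrixInner_transpose (S T : Matrix (Fin n) (Fin n) ℝ) :
    matrixInner Sᵀ Tᵀ = matrixInner S T := by
  simp only [matrixInner, transpose_apply]
  exact Finset.sum_comm

theorem matrixInner_vecMulVec (S : Matrix (Fin n) (Fin n) ℝ) (x : Fin n → ℝ) :
    matrixInner S (vecMulVec x x) = x ⬝ᵥ S *ᵥ x := by
  simp only [matrixInner, vecMulVec_apply, dotProduct, mulVec, Finset.mul_sum]
  exact Finset.sum_congr rfl fun i _ => Finset.sum_congr rfl fun j _ => by ring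

theorem matrixInner_conj {Q : Matrix (Fin n) (Fin n) ℝ} (hQ : Qᵀ = Q)
    (S T : Matrix (Fin n) (Fin n) ℝ) :
    matrixInner (Q * S * Q) T = matrixInner S (Q * T * Q) := by
  simp only [matrixInner_eq_trace, transpose_mul, hQ]
  rw [Matrix.mul_assoc Q, Matrix.mul_assoc Q, Matrix.trace_mul_comm]
  simp only [Matrix.mul_assoc]

open scoped MatrixOrder in
theorem matrixInner_nonneg {S T : Matrix (Fin n) (Fin n) ℝ} (hS : S.PosSemidef)
    (hT : T.PosSemidef) : 0 ≤ matrixInner S T := by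
  obtain ⟨C, rfl⟩ := CStarAlgebra.nonneg_iff_eq_star_mul_self.1 hT.nonneg
  rw [matrixInner_eq_trace, (posSemidef_iff_real.1 hS).1, ← Matrix.mul_assoc,
    Matrix.trace_mul_comm, ← Matrix.mul_assoc]
  exact (hS.mul_mul_conjTranspose_same C).trace_nonneg

theorem exists_matrixInner_eq (f : Matrix (Fin n) (Fin n) ℝ →ₗ[ℝ] ℝ) :
    ∃ U, ∀ S, f S = matrixInner S U := by
  refine ⟨Matrix.of fun i j => f (Matrix.single i j 1), fun S => ?_⟩
  conv_lhs => rw [Matrix.matrix_eq_sum_single S]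
  simp only [map_sum, matrixInner, of_apply]
  refine Finset.sum_congr rfl fun i _ => Finset.sum_congr rfl fun j _ => ?_
  rw [← smul_eq_mul, ← map_smul, Matrix.smul_single, smul_eq_mul, mul_one]

/-- Every linear functional on matrices agrees on symmetric matrices with the inner product
by a symmetric matrix. -/
theorem exists_symm_matrixInner_eq (f : Matrix (Fin n) (Fin n) ℝ →ₗ[ℝ] ℝ) :
    ∃ U : Matrix (Fin n) (Fin n) ℝ, Uᵀ = U ∧ ∀ S : Matrix (Fin n) (Fin n) ℝ, Sᵀ = S →
      f S = matrixInner S U := by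
  obtain ⟨U, hU⟩ := exists_matrixInner_eq f
  refine ⟨(1 / 2 : ℝ) • (U + Uᵀ), by simp [add_comm], fun S hS => ?_⟩
  have : matrixInner S Uᵀ = matrixInner S U := by
    conv_lhs => rw [← hS]
    exact matrixInner_transpose S U
  rw [matrixInner_smul_right, matrixInner_add_right, this, hU]
  ring

theorem continuous_matrixInner (S : Matrix (Fin n) (Fin n) ℝ) :
    Continuous fun T => matrixInner S T := by
  unfold matrixInner
  fun_prop

theorem isClosed_posSemidef : IsClosed {G : Matrix (Fin n) (Fin n) ℝ | G.PosSemidef} := by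
  simp only [posSemidef_iff_real, Set.ofPred_and, Set.ofPred_forall]
  refine (isClosed_eq (by fun_prop) (by fun_prop)).inter (isClosed_iInter fun x => ?_)
  exact isClosed_le continuous_const (by fun_prop)

/-- Diagonal entries are nonnegative and at most the trace; testing on `eᵢ ± eⱼ` bounds the other
entries by means of diagonal ones. -/
theorem isCompact_posSemidef_trace_le (c : ℝ) :
    IsCompact {G : Matrix (Fin n) (Fin n) ℝ | G.PosSemidef ∧ G.trace ≤ c} := by
  have hbox : IsCompact (Set.univ.pi fun _ : Fin n => Set.univ.pi fun _ : Fin n => Set.Icc (-c) c) :=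
    isCompact_univ_pi fun _ => isCompact_univ_pi fun _ => isCompact_Icc
  refine IsCompact.of_isClosed_subset hbox ?_ ?_
  · exact isClosed_posSemidef.inter (isClosed_le (Continuous.matrix_trace continuous_id) continuous_const)
  · rintro G ⟨hG, hc⟩ i - j -
    have hd : ∀ k, G k k ≤ c := fun k =>
      (Finset.single_le_sum (f := fun k => G k k) (fun k _ => hG.diag_nonneg)
        (Finset.mem_univ k)).trans hc
    obtain ⟨hs, h0⟩ := posSemidef_iff_real.1 hG
    have hij : G j i = G i j := congrFun (congrFun hs i) j
    have hp := h0 (Pi.single i 1 + Pi.single j 1)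
    have hm := h0 (Pi.single i 1 - Pi.single j 1)
    simp [mulVec_add, mulVec_sub, add_dotProduct, sub_dotProduct, dotProduct_add,
      dotProduct_sub] at hp hm
    have := hd i
    have := hd j
    constructor <;> linarith

end SDSystem

/-! ### Duality by separation, and two conic alternatives -/

namespace SDSystem

open Matrix Filter Topology
open scoped NNReal

variable {m n : ℕ}

/-- The linear map `Y ↦ ((A i • Y)ᵢ, B • Y)`. -/
noncomputable def dualMap (P : SDSystem m n) :
    Matrix (Fin n) (Fin n) ℝ →ₗ[ℝ] (Fin m → ℝ) × ℝ :=
  LinearMap.prod (LinearMap.pi fun i => matrixInnerₗ n (P.A i)) (matrixInnerₗ n P.B)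

@[simp] theorem dualMap_apply (P : SDSystem m n) (Y : Matrix (Fin n) (Fin n) ℝ) :
    P.dualMap Y = (fun i => matrixInner (P.A i) Y, matrixInner P.B Y) := rfl

theorem continuous_dualMap (P : SDSystem m n) : Continuous P.dualMap := by
  have h : (P.dualMap : Matrix (Fin n) (Fin n) ℝ → (Fin m → ℝ) × ℝ) =
      fun Y => (fun i => matrixInner (P.A i) Y, matrixInner P.B Y) := rfl
  rw [h]
  exact (continuous_pi fun i => continuous_matrixInner _).prodMk (continuous_matrixInner _)

/-- If the image of the semidefinite cone under `dualMap` is closed, there is no duality gap and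
the dual value is attained. -/
theorem wellBehaved_of_isClosed (P : SDSystem m n)
    (hcl : IsClosed (P.dualMap '' {Y | Y.PosSemidef})) : P.WellBehaved := by
  intro c v hv
  by_contra hno
  let C : ProperCone ℝ ((Fin m → ℝ) × ℝ) :=
    { carrier := P.dualMap '' {Y | Y.PosSemidef}
      add_mem' := by
        rintro _ _ ⟨Y, hY, rfl⟩ ⟨Y', hY', rfl⟩
        exact ⟨Y + Y', PosSemidef.add hY hY', map_add _ _ _⟩
      zero_mem' := ⟨0, PosSemidef.zero, map_zero _⟩
      smul_mem' := by
        rintro a _ ⟨Y, hY, rfl⟩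
        exact ⟨(a : ℝ) • Y, PosSemidef.smul hY a.2, map_smul _ _ _⟩
      isClosed' := hcl }
  have hC : ((c, v) : (Fin m → ℝ) × ℝ) ∉ C := by
    rintro ⟨Y, hY, h⟩
    simp only [dualMap_apply, Prod.mk.injEq] at h
    exact hno ⟨Y, ⟨hY, fun i => congrFun h.1 i⟩, h.2⟩
  obtain ⟨f, hf, hneg⟩ := C.hyperplane_separation_point hC
  set x : Fin m → ℝ := fun i => f (Pi.single i 1, 0) with hx
  set t : ℝ := f (0, 1) with ht
  have hfe : ∀ a b, f (a, b) = ∑ i, a i * x i + b * t := by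
    intro a b
    have h1 : ((a, b) : (Fin m → ℝ) × ℝ) =
        ∑ i, a i • ((Pi.single i 1, 0) : (Fin m → ℝ) × ℝ) + b • ((0, 1) : (Fin m → ℝ) × ℝ) := by
      refine Prod.ext ?_ ?_
      · ext j
        simp [Prod.fst_sum, Finset.sum_apply, Pi.single_apply]
      · simp [Prod.snd_sum]
    rw [h1, map_add, map_sum]
    simp only [map_smul, smul_eq_mul, hx, ht]
  have hS : ((∑ i, x i • P.A i) + t • P.B).PosSemidef := by
    refine posSemidef_iff_real.2 ⟨?_, fun w => ?_⟩
    · rw [transpose_add, transpose_smul, P.B_symm.eq, (P.isSymm_combination x).eq]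
    · have := hf _ ⟨vecMulVec w w, by simpa using posSemidef_vecMulVec_self_star w, rfl⟩
      rw [dualMap_apply, hfe] at this
      rw [← matrixInner_vecMulVec, matrixInner_add_left, matrixInner_smul_left,
        matrixInner_sum_smul_left]
      simpa only [mul_comm] using this
  rw [hfe] at hneg
  -- The sign of `t` is unknown. Adding `k` times the slack of a nearly optimal `y` makes the
  -- coefficient of `B` positive, so the sum is a multiple of a slack.
  set k : ℝ := |t| + 1 with hk
  have hk0 : 0 < k := by positivity
  have htk : 0 < t + k := by have := neg_abs_le t; linarith
  -- Chosen so that `δ * k` is the separation gap: a `y` within `δ` of the supremum then yields a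
  -- feasible point of value above `v`.
  set δ : ℝ := -(∑ i, c i * x i + v * t) / k with hδ
  have hδ0 : 0 < δ := div_pos (by linarith) hk0
  have hδk : δ * k = -(∑ i, c i * x i + v * t) := by rw [hδ]; field_simp
  obtain ⟨_, ⟨y, hy, rfl⟩, hyv⟩ := (lt_isLUB_iff hv).1 (sub_lt_self v hδ0)
  have hz : (t + k)⁻¹ • (k • y - x) ∈ P.feasibleSet := by
    have e : P.B - ∑ i, ((t + k)⁻¹ • (k • y - x)) i • P.A i =
        (t + k)⁻¹ • (((∑ i, x i • P.A i) + t • P.B) + k • (P.B - ∑ i, y i • P.A i)) := by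
      have e1 : ∑ i, ((t + k)⁻¹ • (k • y - x)) i • P.A i =
          (t + k)⁻¹ • (k • ∑ i, y i • P.A i - ∑ i, x i • P.A i) := by
        simp [Finset.smul_sum, smul_smul, sub_smul, mul_sub, Finset.sum_sub_distrib, smul_sub]
      have e2 : P.B = (t + k)⁻¹ • ((t + k) • P.B) := by rw [smul_smul, inv_mul_cancel₀ htk.ne', one_smul]
      rw [e1]
      nth_rewrite 1 [e2]
      rw [← smul_sub]
      congr 1
      module
    change PosSemidef _
    rw [e]
    exact (hS.add (PosSemidef.smul hy hk0.le)).smul (inv_pos.2 htk).le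
  have hle := hv.1 ⟨_, hz, rfl⟩
  have e3 : ∑ i, c i * ((t + k)⁻¹ • (k • y - x)) i =
      (t + k)⁻¹ * (k * ∑ i, c i * y i - ∑ i, c i * x i) := by
    simp only [Pi.smul_apply, Pi.sub_apply, smul_eq_mul, Finset.mul_sum, ← Finset.sum_sub_distrib]
    exact Finset.sum_congr rfl fun i _ => by ring
  simp only [e3] at hle
  rw [inv_mul_le_iff₀ htk] at hle
  have := mul_lt_mul_of_pos_left hyv hk0
  nlinarith

/-- A conic alternative: if no nonzero matrix `Q V Q` with `V` in the span of the `A i` is positive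
semidefinite, some positive definite form on `range Q` is orthogonal to all of them. -/
theorem exists_posDef_orthogonal (P : SDSystem m n) {Q : Matrix (Fin n) (Fin n) ℝ}
    (hQs : Qᵀ = Q)
    (hV : ∀ y : Fin m → ℝ, (Q * (∑ i, y i • P.A i) * Q).PosSemidef →
      Q * (∑ i, y i • P.A i) * Q = 0) :
    ∃ H : Matrix (Fin n) (Fin n) ℝ, Hᵀ = H ∧ (∀ i, matrixInner (P.A i) (Q * H * Q) = 0) ∧
      ∀ w, Q *ᵥ w = w → w ≠ 0 → 0 < w ⬝ᵥ H *ᵥ w := by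
  let g : (Fin m → ℝ) →ₗ[ℝ] Matrix (Fin n) (Fin n) ℝ :=
    LinearMap.mulRight ℝ Q ∘ₗ LinearMap.mulLeft ℝ Q ∘ₗ Fintype.linearCombination ℝ P.A
  have hg : ∀ y, g y = Q * (∑ i, y i • P.A i) * Q := fun y => by
    rw [← Fintype.linearCombination_apply]; rfl
  -- The slice `K` is a compact base of the semidefinite cone, and `hV` keeps it off the subspace of
  -- all `QVQ`. The separating functional vanishes on that subspace, and its negative is represented
  -- by `H`.
  let K : Set (Matrix (Fin n) (Fin n) ℝ) := {G | G.PosSemidef ∧ G.trace = 1}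
  have hKc : IsCompact K := by
    refine (isCompact_posSemidef_trace_le 1).of_isClosed_subset ?_ fun G hG => ⟨hG.1, hG.2.le⟩
    exact isClosed_posSemidef.inter
      (isClosed_eq (Continuous.matrix_trace continuous_id) continuous_const)
  have hKconv : Convex ℝ K := by
    rintro G ⟨hG, hG1⟩ G' ⟨hG', hG1'⟩ a b ha hb hab
    refine ⟨(hG.smul ha).add (hG'.smul hb), ?_⟩
    rw [trace_add, trace_smul, trace_smul, hG1, hG1']
    simpa using hab
  let C : ProperCone ℝ (Matrix (Fin n) (Fin n) ℝ) :=
    { (LinearMap.range g).restrictScalars ℝ≥0 with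
      isClosed' := (LinearMap.range g).closed_of_finiteDimensional }
  have hdisj : Disjoint K (C : Set (Matrix (Fin n) (Fin n) ℝ)) := by
    rw [Set.disjoint_left]
    rintro _ ⟨hG, hG1⟩ ⟨y, rfl⟩
    rw [hg] at hG hG1
    rw [hV y hG] at hG1
    simp at hG1
  have : LocallyConvexSpace ℝ (Matrix (Fin n) (Fin n) ℝ) :=
    inferInstanceAs (LocallyConvexSpace ℝ (Fin n → Fin n → ℝ))
  obtain ⟨f, hf, hfK⟩ := C.hyperplane_separation hKconv hKc hdisj
  obtain ⟨H, hHs, hH⟩ := exists_symm_matrixInner_eq (-(f : Matrix (Fin n) (Fin n) ℝ →ₗ[ℝ] ℝ))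
  refine ⟨H, hHs, fun i => ?_, fun w hw hw0 => ?_⟩
  · have hs : (Q * P.A i * Q)ᵀ = Q * P.A i * Q := by
      simp [transpose_mul, hQs, (P.A_symm i).eq, Matrix.mul_assoc]
    have hgi : g (Pi.single i 1) = Q * P.A i * Q := by
      simp [g]
    have h1 : 0 ≤ f (Q * P.A i * Q) := hf _ ⟨_, hgi⟩
    have h2 : 0 ≤ f (-(Q * P.A i * Q)) := hf _ ⟨-Pi.single i 1, by rw [map_neg, hgi]⟩
    rw [map_neg] at h2
    rw [← matrixInner_conj hQs, ← hH _ hs]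
    simp only [LinearMap.neg_apply, ContinuousLinearMap.coe_coe]
    linarith
  · have hww : 0 < w ⬝ᵥ w := by simpa using dotProduct_star_self_pos_iff.2 hw0
    have hk : (w ⬝ᵥ w)⁻¹ • vecMulVec w w ∈ K := by
      refine ⟨PosSemidef.smul (by simpa using posSemidef_vecMulVec_self_star w)
        (inv_pos.2 hww).le, ?_⟩
      rw [trace_smul, trace_vecMulVec, smul_eq_mul, inv_mul_cancel₀ hww.ne']
    have h3 := hfK _ hk
    have hs : ((w ⬝ᵥ w)⁻¹ • vecMulVec w w)ᵀ = (w ⬝ᵥ w)⁻¹ • vecMulVec w w := by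
      rw [transpose_smul, transpose_vecMulVec]
    have h4 := hH _ hs
    simp only [LinearMap.neg_apply, ContinuousLinearMap.coe_coe] at h4
    rw [matrixInner_smul_left, matrixInner_comm, matrixInner_vecMulVec] at h4
    have h5 : 0 < (w ⬝ᵥ w)⁻¹ * (w ⬝ᵥ H *ᵥ w) := by linarith
    exact pos_of_mul_pos_right h5 (inv_pos.2 hww).le

/-- If every form in the span of the `A i` that vanishes on `range Q` has `range Q` in its kernel,
the mixed blocks of a matrix can be absorbed into its `Q`-block without changing the inner
products with the `A i`. -/
theorem exists_block_diagonal (P : SDSystem m n) {Q : Matrix (Fin n) (Fin n) ℝ}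
    (hQs : Qᵀ = Q) (hV : ∀ y : Fin m → ℝ, Q * (∑ i, y i • P.A i) * Q = 0 →
      (∑ i, y i • P.A i) * Q = 0) (Y : Matrix (Fin n) (Fin n) ℝ) :
    ∃ U : Matrix (Fin n) (Fin n) ℝ, Uᵀ = U ∧ ∀ i,
      matrixInner (P.A i) Y = matrixInner (P.A i) ((1 - Q) * Y * (1 - Q) + Q * U * Q) := by
  let l := Fintype.linearCombination ℝ P.A
  have hl : ∀ y, l y = ∑ i, y i • P.A i := fun y => by simp [l, Fintype.linearCombination_apply]
  let g : (Fin m → ℝ) →ₗ[ℝ] Matrix (Fin n) (Fin n) ℝ :=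
    LinearMap.mulRight ℝ Q ∘ₗ LinearMap.mulLeft ℝ Q ∘ₗ l
  have hg : ∀ y, g y = Q * l y * Q := fun y => by simp [g]
  -- `f` pairs `V` with the blocks to be absorbed. It vanishes on `ker g`, hence factors through
  -- `g`; the factor is represented by `U`.
  let f : (Fin m → ℝ) →ₗ[ℝ] ℝ := (matrixInnerₗ n).flip (Y - (1 - Q) * Y * (1 - Q)) ∘ₗ l
  have hker : f ∈ (LinearMap.ker g).dualAnnihilator := by
    rw [Submodule.mem_dualAnnihilator]
    intro y hy
    rw [LinearMap.mem_ker, hg, hl] at hy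
    have h1 := hV y hy
    have hs := (P.isSymm_combination y).eq
    have h2 : Q * (∑ i, y i • P.A i) = 0 := by
      have := congrArg transpose h1
      rwa [transpose_mul, hs, hQs, transpose_zero] at this
    have e : Y - (1 - Q) * Y * (1 - Q) = Q * Y * (1 - Q) + Y * Q := by noncomm_ring
    change matrixInner (l y) _ = 0
    rw [e, hl, matrixInner_eq_trace, hs, Matrix.mul_add, trace_add, ← Matrix.mul_assoc,
      ← Matrix.mul_assoc, h1, ← Matrix.mul_assoc, Matrix.trace_mul_comm _ Q, ← Matrix.mul_assoc, h2]
    simp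
  rw [← LinearMap.range_dualMap_eq_dualAnnihilator_ker] at hker
  obtain ⟨h, hh⟩ := hker
  obtain ⟨U, hUs, hU⟩ := exists_symm_matrixInner_eq h
  refine ⟨U, hUs, fun i => ?_⟩
  have hli : l (Pi.single i 1) = P.A i := by simp [l]
  have h1 : f (Pi.single i 1) = h (Q * P.A i * Q) := by
    rw [← hh, LinearMap.dualMap_apply, hg, hli]
  have hs : (Q * P.A i * Q)ᵀ = Q * P.A i * Q := by
    simp [transpose_mul, hQs, (P.A_symm i).eq, Matrix.mul_assoc]
  rw [hU _ hs, matrixInner_conj hQs] at h1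
  have h2 : f (Pi.single i 1) = matrixInner (P.A i) (Y - (1 - Q) * Y * (1 - Q)) := by
    change matrixInner (l _) _ = _
    rw [hli]
  rw [h2, matrixInner_sub_right] at h1
  rw [matrixInner_add_right]
  linarith

end SDSystem

/-! ### Closedness of the dual image, and the certificate -/

namespace SDSystem

open Matrix Filter Topology

variable {m n : ℕ}

/-- Let `Z` be a slack matrix such that every form in the span of the `A i` that is nonnegative on
`ker Z` annihilates `ker Z`. Then the image of the semidefinite cone under `dualMap` is closed. -/
theorem isClosed_image_dualMap (P : SDSystem m n) {x₀ : Fin m → ℝ} (hx₀ : x₀ ∈ P.feasibleSet)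
    (hV : ∀ y : Fin m → ℝ,
      (∀ w, (P.B - ∑ i, x₀ i • P.A i) *ᵥ w = 0 → 0 ≤ w ⬝ᵥ (∑ i, y i • P.A i) *ᵥ w) →
      ∀ w, (P.B - ∑ i, x₀ i • P.A i) *ᵥ w = 0 → (∑ i, y i • P.A i) *ᵥ w = 0) :
    IsClosed (P.dualMap '' {Y | Y.PosSemidef}) := by
  obtain ⟨Z, hZdef⟩ : ∃ Z, Z = P.B - ∑ i, x₀ i • P.A i := ⟨_, rfl⟩
  have hZ : Z.PosSemidef := by rw [hZdef]; exact hx₀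
  rw [← hZdef] at hV
  have hZs := (posSemidef_iff_real.1 hZ).1
  obtain ⟨Q, hQs, hQQ, hQm, hQf⟩ :=
    exists_orthogonalProjection (LinearMap.ker (Matrix.toLin' Z))
  simp only [LinearMap.mem_ker, Matrix.toLin'_apply] at hQm hQf
  have hZQ : Z * Q = 0 := by
    apply Matrix.toLin'.injective
    apply LinearMap.ext
    intro x
    rw [Matrix.toLin'_apply, ← Matrix.mulVec_mulVec, hQm]
    simp
  have hQZ : Q * Z = 0 := by
    simpa [transpose_mul, hZs, hQs] using congrArg transpose hZQ
  have hVQ : ∀ y : Fin m → ℝ, (Q * (∑ i, y i • P.A i) * Q).PosSemidef →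
      (∑ i, y i • P.A i) * Q = 0 := by
    intro y hy
    have h := hV y fun w hw => by
      have h1 := (posSemidef_iff_real.1 hy).2 w
      rwa [← Matrix.mulVec_mulVec, hQf w hw, ← Matrix.mulVec_mulVec,
        dotProduct_mulVec_comm_of_symm hQs, hQf w hw] at h1
    apply Matrix.toLin'.injective
    apply LinearMap.ext
    intro x
    rw [Matrix.toLin'_apply, ← Matrix.mulVec_mulVec, h _ (hQm x)]
    simp
  obtain ⟨H, hHs, hHA, hHpos⟩ := P.exists_posDef_orthogonal hQs fun y hy => by
    rw [Matrix.mul_assoc, hVQ y hy, Matrix.mul_zero]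
  have hZinner : ∀ Y, matrixInner Z Y =
      matrixInner P.B Y - ∑ i, x₀ i * matrixInner (P.A i) Y := fun Y => by
    rw [hZdef, matrixInner_sub_left, matrixInner_sum_smul_left]
  have hZU : ∀ U, matrixInner Z (Q * U * Q) = 0 := fun U => by
    rw [← matrixInner_conj hQs, hQZ]
    simp [matrixInner]
  set R : Matrix (Fin n) (Fin n) ℝ := 1 - Q with hR
  have hRs : Rᵀ = R := by simp [hR, hQs]
  have hRR : R * R = R := by
    rw [hR, Matrix.sub_mul, Matrix.mul_sub, Matrix.mul_sub, hQQ]; simp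
  have hRQ : R * Q = 0 := by rw [hR, Matrix.sub_mul, hQQ]; simp
  have hRZR : R * Z * R = Z := by
    rw [hR, Matrix.sub_mul, hQZ, sub_zero, Matrix.one_mul, Matrix.mul_sub, hZQ]; simp
  have hdual : ∀ Y Y', (∀ i, matrixInner (P.A i) Y = matrixInner (P.A i) Y') →
      matrixInner Z Y = matrixInner Z Y' → P.dualMap Y = P.dualMap Y' := by
    intro Y Y' h h'
    rw [hZinner, hZinner] at h'
    simp only [h] at h'
    refine Prod.ext (funext h) ?_
    simpa using h'
  have hblock : ∀ Y, ∃ U : Matrix (Fin n) (Fin n) ℝ, Uᵀ = U ∧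
      P.dualMap Y = P.dualMap (R * Y * R + Q * U * Q) := by
    intro Y
    obtain ⟨U, hUs, hU⟩ := P.exists_block_diagonal hQs
      (fun y hy => hVQ y (by rw [hy]; exact PosSemidef.zero)) Y
    refine ⟨U, hUs, hdual _ _ hU ?_⟩
    rw [matrixInner_add_right, hZU, ← matrixInner_conj hRs, hRZR, add_zero]
  -- The `Q`-block may be arbitrary: `dualMap` does not see multiples of `QHQ`, and a large one
  -- makes a symmetric `Q`-block semidefinite.
  have hmem : ∀ G U : Matrix (Fin n) (Fin n) ℝ, G.PosSemidef →
      P.dualMap (G + Q * U * Q) ∈ P.dualMap '' {Y | Y.PosSemidef} := by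
    intro G U hG
    obtain ⟨U', hUs', hU'⟩ := hblock (Q * U * Q)
    have e : R * (Q * U * Q) * R = 0 := by
      rw [← Matrix.mul_assoc, ← Matrix.mul_assoc, hRQ]; simp
    rw [e, zero_add] at hU'
    have hQHQ : (Q * H * Q).PosSemidef := by
      refine posSemidef_iff_real.2 ⟨by simp [transpose_mul, hQs, hHs, Matrix.mul_assoc], ?_⟩
      intro x
      rw [← Matrix.mulVec_mulVec, ← Matrix.mulVec_mulVec, dotProduct_mulVec_comm_of_symm hQs]
      rcases eq_or_ne (Q *ᵥ x) 0 with h | h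
      · simp [h]
      · exact (hHpos _ (by rw [Matrix.mulVec_mulVec, hQQ]) h).le
    have hkill : ∀ w, (Q * H * Q) *ᵥ w = 0 → (Q * U' * Q) *ᵥ w = 0 := by
      intro w hw
      have h1 : (Q *ᵥ w) ⬝ᵥ H *ᵥ (Q *ᵥ w) = 0 := by
        rw [← dotProduct_mulVec_comm_of_symm hQs, Matrix.mulVec_mulVec, Matrix.mulVec_mulVec,
          hw, dotProduct_zero]
      have h2 : Q *ᵥ w = 0 := by
        by_contra h
        exact (hHpos _ (by rw [Matrix.mulVec_mulVec, hQQ]) h).ne' h1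
      rw [← Matrix.mulVec_mulVec, h2, Matrix.mulVec_zero]
    obtain ⟨t, -, ht⟩ := exists_add_smul_posSemidef (V := Q * U' * Q)
      (by simp [transpose_mul, hQs, hUs', Matrix.mul_assoc]) hQHQ
      (fun w hw => by rw [hkill w hw, dotProduct_zero]) (fun w hw _ => hkill w hw)
    have hW : P.dualMap (Q * H * Q) = 0 := by
      rw [← map_zero P.dualMap]
      refine hdual _ _ (fun i => ?_) ?_
      · rw [hHA]; simp [matrixInner]
      · rw [hZU]; simp [matrixInner]
    refine ⟨G + (Q * U' * Q + t • (Q * H * Q)), hG.add ht, ?_⟩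
    rw [map_add, map_add, map_smul, hW, smul_zero, add_zero, map_add, hU']
  -- Since `R` vanishes on `ker Z`, it is dominated by `tZ`; hence `Z • Y` controls the trace of
  -- `RYR`.
  obtain ⟨t, ht0, ht⟩ := exists_add_smul_posSemidef (V := -R) (by simp [hRs]) hZ
    (fun w hw => by simp [hR, Matrix.sub_mulVec, hQf w hw])
    (fun w hw _ => by simp [hR, Matrix.sub_mulVec, hQf w hw])
  have htrace : ∀ Y : Matrix (Fin n) (Fin n) ℝ, Y.PosSemidef →
      (R * Y * R).trace ≤ t * matrixInner Z Y := by
    intro Y hY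
    have h := matrixInner_nonneg ht hY
    rw [matrixInner_add_left, matrixInner_smul_left, ← neg_one_smul ℝ R, matrixInner_smul_left,
      matrixInner_eq_trace R, hRs] at h
    rw [Matrix.trace_mul_comm, ← Matrix.mul_assoc, hRR]
    linarith
  refine IsSeqClosed.isClosed fun s l hs hl => ?_
  choose Y hY hYs using hs
  choose U hUs hU using fun k => hblock (Y k)
  -- `φ (dualMap Y) = Z • Y`, so convergence of the images bounds the blocks `RYR`.
  let φ : (Fin m → ℝ) × ℝ → ℝ := fun p => p.2 - ∑ i, x₀ i * p.1 i
  have hφ : Continuous φ := by fun_prop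
  obtain ⟨c, hc⟩ := ((hφ.tendsto l).comp hl).bddAbove_range
  have hK : ∀ k, R * Y k * R ∈
      {G : Matrix (Fin n) (Fin n) ℝ | G.PosSemidef ∧ G.trace ≤ t * c} := by
    intro k
    refine ⟨?_, (htrace _ (hY k)).trans (mul_le_mul_of_nonneg_left ?_ ht0.le)⟩
    · have := PosSemidef.mul_mul_conjTranspose_same (hY k) R
      rwa [Matrix.conjTranspose_eq_transpose_of_trivial, hRs] at this
    · have h : φ (s k) ≤ c := hc ⟨k, rfl⟩
      rw [← hYs k, dualMap_apply] at h
      rw [hZinner]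
      exact h
  have : FirstCountableTopology (Matrix (Fin n) (Fin n) ℝ) :=
    inferInstanceAs (FirstCountableTopology (Fin n → Fin n → ℝ))
  obtain ⟨G, hG, σ, hσ, hlim⟩ := (isCompact_posSemidef_trace_le (t * c)).tendsto_subseq hK
  -- The `Q`-blocks need not converge; their images lie in a finite-dimensional, hence closed,
  -- subspace.
  let S : Submodule ℝ ((Fin m → ℝ) × ℝ) :=
    LinearMap.range (P.dualMap ∘ₗ LinearMap.mulRight ℝ Q ∘ₗ LinearMap.mulLeft ℝ Q)
  have hS : l - P.dualMap G ∈ S := by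
    have hS' : IsClosed (S : Set ((Fin m → ℝ) × ℝ)) := S.closed_of_finiteDimensional
    refine hS'.mem_of_tendsto ((hl.comp hσ.tendsto_atTop).sub
      ((P.continuous_dualMap.tendsto G).comp hlim)) (Eventually.of_forall fun k => ?_)
    refine ⟨U (σ k), ?_⟩
    change P.dualMap (Q * U (σ k) * Q) = s (σ k) - P.dualMap (R * Y (σ k) * R)
    rw [← hYs, hU (σ k), map_add]
    simp
  obtain ⟨U₀, hU₀⟩ := hS
  have hl' : l = P.dualMap (G + Q * U₀ * Q) := by
    have : P.dualMap (Q * U₀ * Q) = l - P.dualMap G := hU₀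
    rw [map_add, this]; simp
  rw [hl']
  exact hmem _ _ hG.1

/-- A feasible system has a slack matrix whose kernel is contained in the kernel of every other
slack matrix. -/
theorem exists_minimal_slack (P : SDSystem m n) (hne : P.feasibleSet.Nonempty) :
    ∃ x₀ ∈ P.feasibleSet, ∀ x ∈ P.feasibleSet, ∀ w,
      (P.B - ∑ i, x₀ i • P.A i) *ᵥ w = 0 → (P.B - ∑ i, x i • P.A i) *ᵥ w = 0 := by
  let d : (Fin m → ℝ) → ℕ := fun x =>
    Module.finrank ℝ (LinearMap.ker (Matrix.toLin' (P.B - ∑ i, x i • P.A i)))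
  obtain ⟨x₀, hx₀, hmin⟩ : ∃ x₀ ∈ P.feasibleSet, ∀ x ∈ P.feasibleSet, d x₀ ≤ d x := by
    obtain ⟨x₀, hx₀, h⟩ := exists_minimalFor_of_wellFoundedLT (· ∈ P.feasibleSet) d hne
    exact ⟨x₀, hx₀, fun x hx => (le_total (d x₀) (d x)).elim id fun h' => h hx h'⟩
  refine ⟨x₀, hx₀, fun x hx w hw => ?_⟩
  -- The kernel of the midpoint slack is the intersection of the two kernels, so minimal dimension
  -- forces equality.
  set z : Fin m → ℝ := (1 / 2 : ℝ) • (x₀ + x) with hz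
  have e : P.B - ∑ i, z i • P.A i =
      (1 / 2 : ℝ) • ((P.B - ∑ i, x₀ i • P.A i) + (P.B - ∑ i, x i • P.A i)) := by
    have : ∑ i, z i • P.A i = (1 / 2 : ℝ) • (∑ i, x₀ i • P.A i + ∑ i, x i • P.A i) := by
      rw [← Finset.sum_add_distrib, Finset.smul_sum]
      refine Finset.sum_congr rfl fun i _ => ?_
      rw [← add_smul, smul_smul]
      rfl
    rw [this]
    module
  have hzf : z ∈ P.feasibleSet := by
    change PosSemidef _
    rw [e]
    exact (PosSemidef.add hx₀ hx).smul (by norm_num)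
  have hker : ∀ u, (P.B - ∑ i, z i • P.A i) *ᵥ u = 0 →
      (P.B - ∑ i, x₀ i • P.A i) *ᵥ u = 0 ∧ (P.B - ∑ i, x i • P.A i) *ᵥ u = 0 := by
    intro u hu
    have h1 := (posSemidef_iff_real.1 hx₀).2 u
    have h2 := (posSemidef_iff_real.1 hx).2 u
    have h3 : u ⬝ᵥ (P.B - ∑ i, z i • P.A i) *ᵥ u = 0 := by rw [hu, dotProduct_zero]
    rw [e, Matrix.smul_mulVec, Matrix.add_mulVec, dotProduct_smul, dotProduct_add,
      smul_eq_mul] at h3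
    exact ⟨PosSemidef.mulVec_eq_zero hx₀ (by linarith), PosSemidef.mulVec_eq_zero hx (by linarith)⟩
  have hle : LinearMap.ker (Matrix.toLin' (P.B - ∑ i, z i • P.A i)) ≤
      LinearMap.ker (Matrix.toLin' (P.B - ∑ i, x₀ i • P.A i)) := fun u hu => by
    simp only [LinearMap.mem_ker, Matrix.toLin'_apply] at hu ⊢
    exact (hker u hu).1
  have heq := Submodule.eq_of_le_of_finrank_le hle (hmin z hzf)
  have hw' : w ∈ LinearMap.ker (Matrix.toLin' (P.B - ∑ i, z i • P.A i)) := by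
    rwa [heq, LinearMap.mem_ker, Matrix.toLin'_apply]
  rw [LinearMap.mem_ker, Matrix.toLin'_apply] at hw'
  exact (hker w hw').2

/-- In a badly behaved system, some form in the span of the `A i` is nonnegative on the kernel of a
slack matrix `Z`, and has an isotropic vector there that is not in its kernel. -/
theorem BadlyBehaved.exists_certificate {P : SDSystem m n} (hP : P.BadlyBehaved) :
    ∃ x₀ ∈ P.feasibleSet, ∃ (y : Fin m → ℝ) (w : Fin n → ℝ),
      (∀ u, (P.B - ∑ i, x₀ i • P.A i) *ᵥ u = 0 → 0 ≤ u ⬝ᵥ (∑ i, y i • P.A i) *ᵥ u) ∧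
      (P.B - ∑ i, x₀ i • P.A i) *ᵥ w = 0 ∧ w ⬝ᵥ (∑ i, y i • P.A i) *ᵥ w = 0 ∧
      (∑ i, y i • P.A i) *ᵥ w ≠ 0 := by
  have hne : P.feasibleSet.Nonempty := by
    by_contra h
    rw [Set.not_nonempty_iff_eq_empty] at h
    refine hP fun c v hv => ?_
    rw [HasFiniteValue, h, Set.image_empty, isLUB_empty_iff] at hv
    exact absurd (hv (v - 1)) (by simp)
  obtain ⟨x₀, hx₀, hmin⟩ := P.exists_minimal_slack hne
  by_contra hno
  push Not at hno
  refine hP (P.wellBehaved_of_isClosed (P.isClosed_image_dualMap hx₀ fun y hy w hw => ?_))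
  obtain ⟨t, ht0, ht⟩ := exists_add_smul_posSemidef (P.isSymm_combination y).eq hx₀ hy
    (fun w hw hw0 => hno x₀ hx₀ y w hy hw hw0)
  have e : P.B - ∑ i, (x₀ - t⁻¹ • y) i • P.A i =
      t⁻¹ • (∑ i, y i • P.A i + t • (P.B - ∑ i, x₀ i • P.A i)) := by
    have : ∑ i, (x₀ - t⁻¹ • y) i • P.A i = ∑ i, x₀ i • P.A i - t⁻¹ • ∑ i, y i • P.A i := by
      simp [Finset.smul_sum, smul_smul, sub_smul, Finset.sum_sub_distrib]
    rw [this, smul_add, smul_smul, inv_mul_cancel₀ ht0.ne']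
    module
  have hf : x₀ - t⁻¹ • y ∈ P.feasibleSet := by
    change PosSemidef _
    rw [e]
    exact ht.smul (inv_pos.2 ht0).le
  have h := hmin _ hf w hw
  rw [e, Matrix.smul_mulVec, Matrix.add_mulVec, Matrix.smul_mulVec, hw, smul_zero, add_zero] at h
  exact (smul_eq_zero.1 h).resolve_left (inv_ne_zero ht0.ne')

end SDSystem

/-! ### Reduction to the 2×2 system -/

namespace SDSystem

open Matrix

variable {m n : ℕ}

theorem ReducesTo.trans {m₁ n₁ m₂ n₂ : ℕ} {P : SDSystem m n} {Q : SDSystem m₁ n₁}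
    {R : SDSystem m₂ n₂} (h : P.ReducesTo Q) (h' : Q.ReducesTo R) : P.ReducesTo R := by
  induction h' with
  | refl => exact h
  | tail _ hs ih => exact ih.tail hs

theorem Step.reducesTo {m₁ n₁ : ℕ} {P : SDSystem m n} {Q : SDSystem m₁ n₁} (h : Step P Q) :
    P.ReducesTo Q :=
  ReducesTo.refl.tail h

/-- The system in one variable with the single matrix `V`. -/
def single (V B : Matrix (Fin n) (Fin n) ℝ) (hV : V.IsSymm) (hB : B.IsSymm) : SDSystem 1 n where
  A := fun _ => V
  B := B
  A_symm := fun _ => hV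
  B_symm := hB

theorem reducesTo_single (P : SDSystem m n) (i : Fin m) :
    P.ReducesTo (single (P.A i) P.B (P.A_symm i) P.B_symm) := by
  induction m with
  | zero => exact i.elim0
  | succ m ih =>
    rcases Nat.eq_zero_or_pos m with rfl | hm
    · have : P = single (P.A i) P.B (P.A_symm i) P.B_symm := by
        ext1
        · funext j
          have : Subsingleton (Fin (0 + 1)) := inferInstanceAs (Subsingleton (Fin 1))
          rw [Subsingleton.elim j i]; rfl
        · rfl
      rw [← this]
      exact ReducesTo.refl
    · obtain ⟨j, hj⟩ : ∃ j : Fin (m + 1), i ≠ j := by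
        have : Nontrivial (Fin (m + 1)) := Fin.nontrivial_iff_two_le.2 (by omega)
        obtain ⟨j, hj⟩ := exists_ne i
        exact ⟨j, hj.symm⟩
      obtain ⟨k, rfl⟩ := Fin.exists_succAbove_eq hj
      exact (Step.matrixDeletion P j).reducesTo.trans (ih (P.deleteMatrix j) k)

/-- The system obtained by keeping the rows and columns in the range of `f`. -/
def restrict {k : ℕ} (P : SDSystem m n) (f : Fin k → Fin n) : SDSystem m k where
  A := fun i => (P.A i).submatrix f f
  B := P.B.submatrix f f
  A_symm := fun i => (P.A_symm i).submatrix _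
  B_symm := P.B_symm.submatrix _

/-- The last index is deleted each time, so the surviving ones keep their positions. -/
theorem reducesTo_restrict_castAdd {k : ℕ} (l : ℕ) (P : SDSystem m (k + l)) :
    P.ReducesTo (P.restrict (Fin.castAdd l)) := by
  induction l with
  | zero => exact ReducesTo.refl
  | succ l ih =>
    refine (Step.rowColDeletion (n := k + l) P (Fin.last _)).reducesTo.trans ?_
    convert ih (deleteRowCol (n := k + l) P (Fin.last _)) using 1
    ext1
    · funext i
      ext a b
      simp only [restrict, deleteRowCol, submatrix_apply, Fin.succAbove_last]
      rfl
    · ext a b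
      simp only [restrict, deleteRowCol, submatrix_apply, Fin.succAbove_last]
      rfl

/-- Two linearly independent vectors of `ℝⁿ` are the first two columns of an invertible matrix. -/
theorem exists_isUnit_matrix_col {v : Fin 2 → Fin n → ℝ} (hv : LinearIndependent ℝ v) :
    ∃ (l : ℕ) (e : n = 2 + l) (T : Matrix (Fin n) (Fin n) ℝ), IsUnit T ∧
      ∀ i : Fin 2, T.col (Fin.cast e.symm (Fin.castAdd l i)) = v i := by
  let b := Module.Basis.sumExtend hv
  have : Finite (Fin 2 ⊕ Module.Basis.sumExtendIndex hv) := Module.Finite.finite_basis b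
  have : Finite (Module.Basis.sumExtendIndex hv) := Finite.sum_right (Fin 2)
  have := Fintype.ofFinite (Module.Basis.sumExtendIndex hv)
  obtain ⟨l, hl⟩ : ∃ l, l = Fintype.card (Module.Basis.sumExtendIndex hv) := ⟨_, rfl⟩
  have e : n = 2 + l := by
    have h := Module.finrank_eq_card_basis b
    rw [Module.finrank_fin_fun, Fintype.card_sum, Fintype.card_fin] at h
    omega
  subst e
  let ε : Fin 2 ⊕ Module.Basis.sumExtendIndex hv ≃ Fin (2 + l) :=
    ((Equiv.refl _).sumCongr (Fintype.equivFinOfCardEq hl.symm)).trans finSumFinEquiv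
  let b' := b.reindex ε
  refine ⟨l, rfl, (Matrix.of b')ᵀ, ?_, fun i => ?_⟩
  · rw [← Matrix.linearIndependent_cols_iff_isUnit]
    exact b'.linearIndependent
  · have h : ε (Sum.inl i) = Fin.castAdd l i := rfl
    change b' (Fin.castAdd l i) = v i
    rw [← h, Module.Basis.reindex_apply, Equiv.symm_apply_apply]
    simp only [b, Module.Basis.sumExtend, Module.Basis.coe_reindex,
      Function.comp_apply, Module.Basis.extend_apply_self]
    rfl

/-- The leading 2×2 block after a rotation thus depends only on the first two columns of `T`. -/
theorem conj_apply_eq (T S : Matrix (Fin n) (Fin n) ℝ) (a b : Fin n) :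
    (Tᵀ * S * T) a b = T.col a ⬝ᵥ S *ᵥ T.col b := by
  rw [Matrix.mul_assoc]
  rfl

/-- The vectors `u, w` are independent because `uᵀZu = 1` while `Zw = 0`. In a basis starting with
them the leading blocks are the Gram matrices of `V` and `Z`, and `α = uᵀVu`. -/
theorem exists_reducesTo_badMinor {V Z : Matrix (Fin n) (Fin n) ℝ} (hV : V.IsSymm) (hZ : Z.IsSymm)
    {u w : Fin n → ℝ} (hw : Z *ᵥ w = 0) (hwV : w ⬝ᵥ V *ᵥ w = 0) (huV : u ⬝ᵥ V *ᵥ w = 1)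
    (hu : u ⬝ᵥ Z *ᵥ u = 1) : ∃ α : ℝ, (single V Z hV hZ).ReducesTo (badMinor α) := by
  have hlin : LinearIndependent ℝ ![u, w] := by
    rw [LinearIndependent.pair_iff]
    intro s t h
    have h1 : s * (u ⬝ᵥ Z *ᵥ u) + t * (u ⬝ᵥ Z *ᵥ w) = 0 := by
      rw [← smul_eq_mul, ← smul_eq_mul, ← dotProduct_smul, ← dotProduct_smul, ← dotProduct_add,
        ← Matrix.mulVec_smul, ← Matrix.mulVec_smul, ← Matrix.mulVec_add, h]
      simp
    rw [hu, hw, dotProduct_zero, mul_one, mul_zero, add_zero] at h1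
    rw [h1, zero_smul, zero_add] at h
    refine ⟨h1, (smul_eq_zero.1 h).resolve_right fun h0 => ?_⟩
    simp [h0] at huV
  obtain ⟨l, rfl, T, hT, hcol⟩ := exists_isUnit_matrix_col hlin
  have h0 := hcol 0
  have h1 := hcol 1
  simp only [Fin.cast_eq_self, Matrix.cons_val_zero, Matrix.cons_val_one] at h0 h1
  refine ⟨u ⬝ᵥ V *ᵥ u, (Step.rotation _ T hT).reducesTo.trans ?_⟩
  convert reducesTo_restrict_castAdd l ((single V Z hV hZ).rotate T) using 1
  have hwu : w ⬝ᵥ V *ᵥ u = 1 := by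
    rw [dotProduct_mulVec_comm_of_symm hV.eq, dotProduct_comm, huV]
  have hwZ : w ⬝ᵥ Z *ᵥ u = 0 := by
    rw [dotProduct_mulVec_comm_of_symm hZ.eq, hw, zero_dotProduct]
  ext1
  · funext i
    ext a b
    change _ = (Tᵀ * V * T) (Fin.castAdd l a) (Fin.castAdd l b)
    rw [conj_apply_eq]
    fin_cases a <;> fin_cases b <;> simp [badMinor, h0, h1, huV, hwV, hwu]
  · ext a b
    change _ = (Tᵀ * Z * T) (Fin.castAdd l a) (Fin.castAdd l b)
    rw [conj_apply_eq]
    fin_cases a <;> fin_cases b <;> simp [badMinor, h0, h1, hu, hw, hwZ]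

theorem exists_reducesTo_badMinor_of_isotropic {V Z : Matrix (Fin n) (Fin n) ℝ} (hV : V.IsSymm)
    (hZs : Z.IsSymm) (hZ : Z.PosSemidef) (hpos : ∀ u, Z *ᵥ u = 0 → 0 ≤ u ⬝ᵥ V *ᵥ u)
    {w : Fin n → ℝ} (hwZ : Z *ᵥ w = 0) (hwV : w ⬝ᵥ V *ᵥ w = 0) (hne : V *ᵥ w ≠ 0) :
    ∃ α : ℝ, (single V Z hV hZs).ReducesTo (badMinor α) := by
  set u := V *ᵥ w with hu
  have huu : 0 < u ⬝ᵥ u := by simpa using dotProduct_star_self_pos_iff.2 hne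
  have huZ : 0 < u ⬝ᵥ Z *ᵥ u := by
    refine lt_of_le_of_ne ((posSemidef_iff_real.1 hZ).2 u) fun h => ?_
    have hZu := hZ.mulVec_eq_zero h.symm
    set b := u ⬝ᵥ V *ᵥ u with hb
    have hb0 : 0 ≤ b := hpos u hZu
    have hwu : w ⬝ᵥ V *ᵥ u = u ⬝ᵥ u := dotProduct_mulVec_comm_of_symm hV.eq w u
    -- If `u ∈ ker Z`, the form at `w - εu` equals `ε(εb - 2 u·u)`, which is negative for this `ε`;
    -- the `+ 1` covers `b = 0`.
    set ε : ℝ := (u ⬝ᵥ u) / (b + 1) with hε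
    have hε0 : 0 < ε := div_pos huu (by linarith)
    have hεb : ε * (b + 1) = u ⬝ᵥ u := div_mul_cancel₀ _ (by linarith)
    have hq := hpos (w - ε • u) (by rw [Matrix.mulVec_sub, Matrix.mulVec_smul, hwZ, hZu]; simp)
    simp only [Matrix.mulVec_sub, Matrix.mulVec_smul, sub_dotProduct, dotProduct_sub,
      smul_dotProduct, dotProduct_smul, hwV, hwu, smul_eq_mul, ← hu, ← hb] at hq
    have hq' : 0 ≤ ε * (ε * b - 2 * (u ⬝ᵥ u)) := by linarith
    have := nonneg_of_mul_nonneg_right hq' hε0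
    linarith
  set q := u ⬝ᵥ Z *ᵥ u with hq
  have hr0 : 0 < √q := Real.sqrt_pos.2 huZ
  have hrr : √q * √q = q := Real.mul_self_sqrt huZ.le
  -- The factor of `u` normalises `uᵀZu`; that of `w` then normalises `uᵀVw`.
  obtain ⟨α, hα⟩ := exists_reducesTo_badMinor hV hZs (u := (√q)⁻¹ • u)
    (w := (√q / (u ⬝ᵥ u)) • w)
    (by rw [Matrix.mulVec_smul, hwZ, smul_zero])
    (by simp [Matrix.mulVec_smul, ← hu, hwV])
    (by
      simp only [Matrix.mulVec_smul, smul_dotProduct, dotProduct_smul, ← hu, smul_eq_mul]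
      field_simp)
    (by
      simp only [Matrix.mulVec_smul, smul_dotProduct, dotProduct_smul, ← hq, smul_eq_mul]
      rw [← mul_assoc, ← mul_inv, hrr, inv_mul_cancel₀ huZ.ne'])
  exact ⟨α, hα⟩

theorem BadlyBehaved.exists_reducesTo_badMinor {P : SDSystem m n} (hP : P.BadlyBehaved) :
    ∃ α : ℝ, P.ReducesTo (badMinor α) := by
  obtain ⟨x₀, hx₀, y, w, hpos, hwZ, hwV, hne⟩ := hP.exists_certificate
  obtain ⟨i, hi⟩ : ∃ i, y i ≠ 0 := by
    by_contra! h
    exact hne (by simp [h])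
  have hred := (Step.contraction P i y (-x₀) hi).reducesTo.trans
    (reducesTo_single (P.contract i y (-x₀)) i)
  have hA : (P.contract i y (-x₀)).A i = ∑ i, y i • P.A i := Function.update_self _ _ _
  have hB : (P.contract i y (-x₀)).B = P.B - ∑ i, x₀ i • P.A i := by
    simp [contract, sub_eq_add_neg]
  rw [← hA] at hpos hwV hne
  rw [← hB] at hpos hwZ
  have hZ : (P.contract i y (-x₀)).B.PosSemidef := by rw [hB]; exact hx₀
  obtain ⟨α, hα⟩ := exists_reducesTo_badMinor_of_isotropic ((P.contract i y (-x₀)).A_symm i)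
    (P.contract i y (-x₀)).B_symm hZ hpos hwZ hwV hne
  exact ⟨α, hred.trans hα⟩

/-! ### The 2×2 system is badly behaved -/

theorem badMinor_feasibleSet (α : ℝ) : (badMinor α).feasibleSet = {0} := by
  ext x
  constructor
  · intro h
    obtain ⟨-, h⟩ := posSemidef_iff_real.1 h
    have hx : ∀ s t : ℝ, 0 ≤ s * (s * (1 - x 0 * α)) - 2 * (s * t * x 0) := by
      intro s t
      have := h ![s, t]
      simp [badMinor, dotProduct, Matrix.mulVec, Fin.sum_univ_two, Matrix.sub_apply] at this
      linarith
    have h0 : x 0 = 0 := by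
      -- At this test vector the slack form equals `-(x 0)²`.
      have h1 := hx (x 0) (((1 - x 0 * α) + 1) / 2)
      have h2 : x 0 * x 0 ≤ 0 := by linarith
      exact mul_self_eq_zero.1 (le_antisymm h2 (mul_self_nonneg _))
    ext i
    rw [Subsingleton.elim i 0, h0]; rfl
  · rintro rfl
    refine posSemidef_iff_real.2 ⟨?_, fun w => ?_⟩
    · simpa using (badMinor α).B_symm.eq
    · simp [badMinor, dotProduct, Matrix.mulVec, Fin.sum_univ_two, mul_self_nonneg]

/-- For `c = 1` the value is 0, the only feasible point being 0. A dual solution attaining it has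
`Y₀₀ = 0`, hence `Y₀₁ = 0` by semidefiniteness, so `A • Y = 0 ≠ 1`. -/
theorem badlyBehaved_badMinor (α : ℝ) : (badMinor α).BadlyBehaved := by
  intro h
  obtain ⟨Y, ⟨hY, hA⟩, hB⟩ := h (fun _ => 1) 0 (by simp [HasFiniteValue, badMinor_feasibleSet])
  have hA0 := hA 0
  simp [matrixInner, badMinor, Fin.sum_univ_two] at hA0 hB
  have hs : Y 1 0 = Y 0 1 := congrFun (congrFun (posSemidef_iff_real.1 hY).1 0) 1
  have h1 : Y *ᵥ ![1, 0] = 0 :=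
    hY.mulVec_eq_zero (by simp [dotProduct, Matrix.mulVec, Fin.sum_univ_two, hB])
  have h2 := congrFun h1 1
  simp [Matrix.mulVec, dotProduct, Fin.sum_univ_two] at h2
  rw [hB, ← hs, h2] at hA0
  norm_num at hA0

end SDSystem

theorem corollary1p1 :
    (∀ (m n : ℕ) (P : SDSystem m n), P.BadlyBehaved →
      ∃ α : ℝ, P.ReducesTo (SDSystem.badMinor α)) ∧
    (∀ α : ℝ, (SDSystem.badMinor α).BadlyBehaved) :=
  ⟨fun _ _ _ hP => hP.exists_reducesTo_badMinor, SDSystem.badlyBehaved_badMinor⟩
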